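/- Let $H$ be a real Hilbert space and let $I,J:H\to\mathbb R$ be continuously Fréchet differentiable functionals whose derivatives $I',J':H\to H$ (identified with gradients via the Riesz isomorphism) are compact, i.e. continuous and mapping bounded sets to relatively compact sets. Assume that the function $2I-J^2$ is bounded on $H$ and that $J$ is not affine. Then, for every convex set $S\subseteq H\times\mathbb R$ that is dense in $H\times\mathbb R$, there exists $(y_0,\lambda_0)\in S$ such that the equation $$x+I'(x)+\lambda_0J'(x)=y_0$$ has at least three distinct solutions $x\in H$. -/

import Mathlib

/-- A (possibly nonlinear) map between normed spaces is compact if it is continuous and maps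
bounded sets to relatively compact sets. (Mathlib's `IsCompactOperator` only looks at a
neighbourhood of the origin, which is the right notion for linear maps only.) -/
def IsCompactMap {E F : Type*} [NormedAddCommGroup E] [NormedAddCommGroup F] (T : E → F) : Prop :=
  Continuous T ∧ ∀ B : Set E, Bornology.IsBounded B → IsCompact (closure (T '' B))

open Filter Topology Set
open scoped RealInnerProductSpace

/-! For `p = (y, λ)` the solutions are the critical points of an energy `f_p(x) = ‖x‖²/2 + I x + λ
(J x - t) - ⟪y, x - a⟫`, for any constants `a`, `t`. Since `2I - J²` is bounded below, `I` dominates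
`J²/2`, so `f_p` is coercive. Compact gradients make `I` and `J` weakly continuous on bounded sets,
so `f_p` attains its minimum.

As `J` is continuous and not affine, it fails to preserve some midpoint: take `a` the midpoint of
`x₁`, `x₂` and `t ≠ J a` the mean of `J x₁`, `J x₂`. Then `f_p(x₁) + f_p(x₂) = 2M` does not depend
on `p`, so `min f_p ≤ M` for all `p`. If minimizers were unique for every `p ∈ S`, a minimax
argument (`exists_tiltedEnergy_le_of_convex`) would give one `x` with `f_p(x) ≤ M` on `S`, and by
density for all `p`. An affine function of `p` bounded above is constant, forcing `x = a` and `J a =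
t`, a contradiction.

So some `f_p` with `p ∈ S` has two global minimizers, and a mountain pass between them yields the
third solution (`IsCompactMap.exists_third_critical_point`). -/

/-- Ekeland's variational principle. -/
theorem LowerSemicontinuous.exists_le_add_mul_dist {X : Type*} [PseudoMetricSpace X]
    [CompleteSpace X] {Φ : X → ℝ} (hΦ : LowerSemicontinuous Φ) {m : ℝ} (hm : ∀ x, m ≤ Φ x)
    {ε : ℝ} (hε : 0 < ε) (x₀ : X) :
    ∃ x, Φ x ≤ Φ x₀ ∧ ∀ z, Φ x ≤ Φ z + ε * dist x z := by
  have step : ∀ (n : ℕ) (x : X), ∃ y, Φ y + ε * dist x y ≤ Φ x ∧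
      ∀ z, Φ z + ε * dist x z ≤ Φ x → Φ y ≤ Φ z + (1 / 2 : ℝ) ^ n := by
    intro n x
    set A := Φ '' {z | Φ z + ε * dist x z ≤ Φ x} with hA
    have hne : A.Nonempty := ⟨Φ x, x, by simp, rfl⟩
    have hbdd : BddBelow A := ⟨m, by rintro _ ⟨z, -, rfl⟩; exact hm z⟩
    obtain ⟨_, ⟨y, hy, rfl⟩, hlt⟩ := exists_lt_of_csInf_lt hne
      (lt_add_of_pos_right (sInf A) (by positivity : (0 : ℝ) < (1 / 2) ^ n))
    refine ⟨y, hy, fun z hz => ?_⟩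
    have := csInf_le hbdd (mem_image_of_mem Φ hz)
    linarith
  choose next hnext hmin using step
  let x : ℕ → X := fun n => Nat.rec x₀ (fun n y => next n y) n
  have hx : ∀ n, x (n + 1) = next n (x n) := fun n => rfl
  have hmono : ∀ n, ∀ k, Φ (x (n + k)) + ε * dist (x n) (x (n + k)) ≤ Φ (x n) := by
    intro n k
    induction k with
    | zero => simp
    | succ k ih =>
      have h1 := hnext (n + k) (x (n + k))
      rw [← hx] at h1
      have h2 := mul_le_mul_of_nonneg_left
        (dist_triangle (x n) (x (n + k)) (x (n + k + 1))) hε.le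
      rw [← add_assoc]
      linarith
  have hmono' : ∀ n p, n ≤ p → Φ (x p) + ε * dist (x n) (x p) ≤ Φ (x n) := by
    intro n p h
    obtain ⟨k, rfl⟩ := Nat.exists_eq_add_of_le h
    exact hmono n k
  have hanti : Antitone fun n => Φ (x n) := by
    intro n p h
    have := hmono' n p h
    have : 0 ≤ ε * dist (x n) (x p) := by positivity
    simp only
    linarith
  have hlim := tendsto_atTop_ciInf hanti ⟨m, by rintro _ ⟨n, rfl⟩; exact hm _⟩
  set a := ⨅ n, Φ (x n)
  have hcauchy : CauchySeq x := by
    rw [Metric.cauchySeq_iff']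
    intro δ hδ
    obtain ⟨N, hN⟩ := (hlim.eventually_lt_const
      (lt_add_of_pos_right a (by positivity : 0 < ε * δ))).exists
    refine ⟨N, fun n hn => ?_⟩
    have h1 := hmono' N n hn
    have h2 : a ≤ Φ (x n) := hanti.le_of_tendsto hlim n
    rw [dist_comm]
    exact lt_of_mul_lt_mul_left (by linarith) hε.le
  obtain ⟨y, hy⟩ := cauchySeq_tendsto_of_complete hcauchy
  have hyn : ∀ n, Φ y + ε * dist (x n) y ≤ Φ (x n) := by
    intro n
    have hlsc : LowerSemicontinuous fun z => Φ z + ε * dist (x n) z :=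
      hΦ.add (Continuous.lowerSemicontinuous (by fun_prop))
    have hcl := hlsc.isClosed_preimage (Φ (x n))
    exact hcl.mem_of_tendsto hy ((eventually_ge_atTop n).mono fun p hp => hmono' n p hp)
  have hya : Φ y ≤ a := ge_of_tendsto' hlim fun n => by
    have := hyn n
    have : 0 ≤ ε * dist (x n) y := by positivity
    linarith
  refine ⟨y, hya.trans (hanti.le_of_tendsto hlim 0), fun z => ?_⟩
  by_contra! hz
  -- A violating `z` would be admissible at every step of the construction, so `a ≤ Φ z` in the
  -- limit, against `Φ z < Φ y ≤ a`.
  have h1 : ∀ n, Φ (x (n + 1)) ≤ Φ z + (1 / 2 : ℝ) ^ n := by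
    intro n
    refine hmin n (x n) z ?_
    have h2 := mul_le_mul_of_nonneg_left (dist_triangle (x n) y z) hε.le
    have h3 := hyn n
    linarith
  have h2 : a ≤ Φ z + 0 := le_of_tendsto_of_tendsto' ((tendsto_add_atTop_iff_nat 1).2 hlim)
    ((tendsto_pow_atTop_nhds_zero_of_lt_one (by norm_num) (by norm_num)).const_add (Φ z)) h1
  have h3 : 0 ≤ ε * dist y z := by positivity
  linarith

/-! ### Mountain pass via Ekeland's principle on path space -/

section MountainPass

variable {E : Type*} [NormedAddCommGroup E] [InnerProductSpace ℝ E] [CompleteSpace E]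

/-- The mean value theorem along the segment from `x` to `x + v`. -/
theorem exists_sub_eq_inner_gradient {f : E → ℝ} {f' : E → E}
    (hf : ∀ x, HasGradientAt f (f' x) x) (x v : E) :
    ∃ θ ∈ Ioo (0 : ℝ) 1, f (x + v) - f x = ⟪f' (x + θ • v), v⟫ := by
  have hd : ∀ t : ℝ, HasDerivAt (fun t : ℝ => f (x + t • v)) ⟪f' (x + t • v), v⟫ t := by
    intro t
    have h1 : HasDerivAt (fun t : ℝ => x + t • v) v t := by
      simpa using ((hasDerivAt_id t).smul_const v).const_add x
    have h2 : HasDerivAt (fun t : ℝ => f (x + t • v)) _ t :=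
      (hf (x + t • v)).hasFDerivAt.comp_hasDerivAt t h1
    simpa using h2
  obtain ⟨θ, hθ, h⟩ := exists_hasDerivAt_eq_slope (fun t : ℝ => f (x + t • v))
    (fun t => ⟪f' (x + t • v), v⟫) zero_lt_one
    (fun t _ => (hd t).continuousAt.continuousWithinAt) (fun t _ => hd t)
  exact ⟨θ, hθ, by simpa using h.symm⟩

/-- The mountain pass theorem, without compactness: there are almost critical points above
the ridge, in a common sublevel set. -/
theorem exists_norm_gradient_le_of_ridge {f : E → ℝ} {f' : E → E}
    (hf : ∀ x, HasGradientAt f (f' x) x) (hf' : Continuous f') {a b : E} {m m' : ℝ}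
    (hm : ∀ x, m ≤ f x) (ha : f a = m) (hb : f b = m) (hmm : m < m')
    (hpath : ∀ γ : C(unitInterval, E), γ 0 = a → γ 1 = b → ∃ t, m' ≤ f (γ t)) :
    ∃ B, ∀ ε > 0, ∃ u, m' ≤ f u ∧ f u ≤ B ∧ ‖f' u‖ ≤ ε := by
  have hfc : Continuous f :=
    continuous_iff_continuousAt.2 fun x => (hf x).hasFDerivAt.continuousAt
  have hmax : ∀ γ : C(unitInterval, E), ∃ t, ∀ s, f (γ s) ≤ f (γ t) := by
    intro γ
    obtain ⟨t, -, ht⟩ := isCompact_univ.exists_isMaxOn univ_nonempty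
      (hfc.comp γ.continuous).continuousOn
    exact ⟨t, fun s => ht (mem_univ s)⟩
  choose τ hτ using hmax
  let P : Set C(unitInterval, E) := {γ | γ 0 = a ∧ γ 1 = b}
  have hP : IsClosed P :=
    (isClosed_eq (by fun_prop) continuous_const).inter (isClosed_eq (by fun_prop) continuous_const)
  have : CompleteSpace P := hP.completeSpace_coe
  let Φ : P → ℝ := fun γ => f (γ.1 (τ γ.1))
  have hΦ : LowerSemicontinuous Φ := by
    intro γ y hy
    have hc : Continuous fun σ : P => f (σ.1 (τ γ.1)) := by fun_prop
    filter_upwards [hc.continuousAt.eventually_const_lt hy] with σ hσ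
    exact hσ.trans_le (hτ σ.1 _)
  let γ₀ : P := ⟨⟨fun t => AffineMap.lineMap a b (t : ℝ), by
    simp only [AffineMap.lineMap_apply_module]; fun_prop⟩, by simp, by simp⟩
  -- The maximum along the segment is a bound independent of `ε`.
  refine ⟨Φ γ₀, fun ε hε => ?_⟩
  obtain ⟨γ, hγ, hek⟩ := hΦ.exists_le_add_mul_dist (m := m) (fun _ => hm _) hε γ₀
  obtain ⟨s, hs⟩ := hpath γ.1 γ.2.1 γ.2.2
  have hΦm : m' ≤ Φ γ := hs.trans (hτ _ _)
  have hpos : 0 < Φ γ - m := by linarith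
  let g : C(unitInterval, E) := ⟨fun t => f' (γ.1 t), by fun_prop⟩
  have hden : ∀ t, 0 < max ‖g t‖ ε := fun t => lt_max_of_lt_right hε
  -- A descent field of norm at most 1: the weight vanishes at the endpoints, keeping them fixed,
  -- and equals 1 where `f ∘ γ` is maximal.
  let v : C(unitInterval, E) :=
    ⟨fun t => -(((f (γ.1 t) - m) / (Φ γ - m)) • (max ‖g t‖ ε)⁻¹ • g t), by
      have h1 : Continuous fun t => (max ‖g t‖ ε)⁻¹ :=
        Continuous.inv₀ (by fun_prop) fun t => (hden t).ne'
      fun_prop⟩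
  have hv : ∀ t, v t = -(((f (γ.1 t) - m) / (Φ γ - m)) • (max ‖g t‖ ε)⁻¹ • g t) := fun t => rfl
  have hvn : ‖v‖ ≤ 1 := by
    rw [ContinuousMap.norm_le _ zero_le_one]
    intro t
    have h1 : |(f (γ.1 t) - m) / (Φ γ - m)| ≤ 1 := by
      rw [abs_of_nonneg (div_nonneg (by linarith [hm (γ.1 t)]) hpos.le), div_le_one hpos]
      linarith [hτ γ.1 t]
    have h2 : (max ‖g t‖ ε)⁻¹ * ‖g t‖ ≤ 1 := by
      rw [inv_mul_le_one₀ (hden t)]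
      exact le_max_left _ _
    rw [hv, norm_neg, norm_smul, norm_smul, norm_inv, Real.norm_eq_abs, Real.norm_eq_abs,
      abs_of_pos (hden t)]
    exact mul_le_one₀ h1 (by positivity) h2
  let r : ℕ → ℝ := fun n => 1 / ((n : ℝ) + 1)
  have hr : ∀ n, 0 < r n := fun n => Nat.one_div_pos_of_nat
  have hr0 : Tendsto r atTop (𝓝 0) := tendsto_one_div_add_atTop_nhds_zero_nat
  let σ : ℕ → P := fun n => ⟨γ.1 + r n • v, by
    simp [hv, γ.2.1, ha], by simp [hv, γ.2.2, hb]⟩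
  have hσ : ∀ n t, (σ n).1 t = γ.1 t + r n • v t := fun n t => rfl
  have hdist : ∀ n, dist γ (σ n) ≤ r n := by
    intro n
    rw [Subtype.dist_eq, dist_eq_norm]
    have : γ.1 - (σ n).1 = -(r n • v) := by simp [σ]
    rw [this, norm_neg, norm_smul, Real.norm_eq_abs, abs_of_pos (hr n)]
    exact mul_le_of_le_one_right (hr n).le hvn
  have hlow : ∀ n, Φ γ - ε * r n ≤ f ((σ n).1 (τ (σ n).1)) := by
    intro n
    have := hek (σ n)
    have := mul_le_mul_of_nonneg_left (hdist n) hε.le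
    change _ ≤ Φ (σ n)
    linarith
  -- Maximum points of the deformed paths accumulate at a maximum point `t` of `f ∘ γ`. Ekeland's
  -- inequality bounds the slope along `v t` below by `-ε`, whereas `‖g t‖ > ε` would make it `-‖g
  -- t‖`.
  obtain ⟨t, φ, hφ, ht⟩ := CompactSpace.tendsto_subseq fun n => τ (σ n).1
  have hrφ := hr0.comp hφ.tendsto_atTop
  have hmv : ∀ n, ∃ θ ∈ Ioo (0 : ℝ) 1,
      -ε ≤ ⟪f' (γ.1 (τ (σ n).1) + θ • r n • v (τ (σ n).1)), v (τ (σ n).1)⟫ := by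
    intro n
    obtain ⟨θ, hθ, h⟩ := exists_sub_eq_inner_gradient hf (γ.1 (τ (σ n).1)) (r n • v (τ (σ n).1))
    refine ⟨θ, hθ, ?_⟩
    rw [← hσ, inner_smul_right] at h
    have h1 := hlow n
    have h2 : f (γ.1 (τ (σ n).1)) ≤ Φ γ := hτ _ _
    have h3 : r n * (-ε) ≤
      r n * ⟪f' (γ.1 (τ (σ n).1) + θ • r n • v (τ (σ n).1)), v (τ (σ n).1)⟫ := by linarith
    exact le_of_mul_le_mul_left h3 (hr n)
  choose θ hθ hθi using hmv
  have hvt : Tendsto (fun n => v (τ (σ (φ n)).1)) atTop (𝓝 (v t)) :=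
    (v.continuous.tendsto t).comp ht
  have hγt : Tendsto (fun n => γ.1 (τ (σ (φ n)).1)) atTop (𝓝 (γ.1 t)) :=
    (γ.1.continuous.tendsto t).comp ht
  have hσt : Tendsto (fun n => (σ (φ n)).1 (τ (σ (φ n)).1)) atTop (𝓝 (γ.1 t)) := by
    simpa [hσ] using hγt.add (hrφ.smul hvt)
  have hft : f (γ.1 t) = Φ γ := by
    refine le_antisymm (hτ _ _) ?_
    have h1 : Tendsto (fun n => Φ γ - ε * r (φ n)) atTop (𝓝 (Φ γ)) := by
      simpa using (hrφ.const_mul ε).const_sub (Φ γ)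
    exact le_of_tendsto_of_tendsto' h1 ((hfc.tendsto _).comp hσt) fun n => hlow (φ n)
  have hθr : Tendsto (fun n => θ (φ n) * r (φ n)) atTop (𝓝 0) :=
    squeeze_zero (fun n => mul_nonneg (hθ _).1.le (hr _).le)
      (fun n => mul_le_of_le_one_left (hr _).le (hθ _).2.le) hrφ
  have hlim : Tendsto (fun n => ⟪f' (γ.1 (τ (σ (φ n)).1) +
      θ (φ n) • r (φ n) • v (τ (σ (φ n)).1)), v (τ (σ (φ n)).1)⟫) atTop (𝓝 ⟪g t, v t⟫) := by
    refine Tendsto.inner (𝕜 := ℝ) ((hf'.tendsto _).comp ?_) hvt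
    simpa [smul_smul] using hγt.add (hθr.smul hvt)
  have hfin : -ε ≤ ⟪g t, v t⟫ := ge_of_tendsto' hlim fun n => hθi (φ n)
  refine ⟨γ.1 t, hft ▸ hΦm, hft ▸ hγ, ?_⟩
  change ‖g t‖ ≤ ε
  by_contra! hlt
  rw [hv, hft, div_self hpos.ne', one_smul, max_eq_left hlt.le, inner_neg_right,
    inner_smul_right, real_inner_self_eq_norm_sq] at hfin
  have : ‖g t‖⁻¹ * ‖g t‖ ^ 2 = ‖g t‖ := by
    have := (hε.trans hlt).ne'
    field_simp
  linarith

end MountainPass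

/-! ### Weak limits and weak semicontinuity -/

section WeakConvergence

variable {E : Type*} [NormedAddCommGroup E] [InnerProductSpace ℝ E] [CompleteSpace E]

/-- Bounded ultrafilters in a Hilbert space converge weakly. -/
theorem Ultrafilter.exists_forall_tendsto_inner {ι : Type*} (U : Ultrafilter ι) {u : ι → E} {R : ℝ}
    (hu : ∀ᶠ i in U, ‖u i‖ ≤ R) : ∃ x, ∀ v, Tendsto (fun i => ⟪u i, v⟫) U (𝓝 ⟪x, v⟫) := by
  have hex : ∀ v : E, ∃ a ∈ Icc (-(R * ‖v‖)) (R * ‖v‖),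
      Tendsto (fun i => ⟪u i, v⟫) U (𝓝 a) := by
    intro v
    have hmem : ∀ᶠ i in U, ⟪u i, v⟫ ∈ Icc (-(R * ‖v‖)) (R * ‖v‖) := by
      filter_upwards [hu] with i hi
      exact abs_le.1 ((abs_real_inner_le_norm _ _).trans
        (mul_le_mul_of_nonneg_right hi (norm_nonneg v)))
    exact isCompact_Icc.ultrafilter_le_nhds (U.map fun i => ⟪u i, v⟫)
      (le_principal_iff.2 hmem)
  choose a ha hlim using hex
  let L : E →ₗ[ℝ] ℝ :=
    { toFun := a
      map_add' := fun v w => by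
        refine tendsto_nhds_unique (hlim (v + w)) ?_
        simpa only [inner_add_right] using (hlim v).add (hlim w)
      map_smul' := fun c v => by
        refine tendsto_nhds_unique (hlim (c • v)) ?_
        simpa only [inner_smul_right, smul_eq_mul, RingHom.id_apply] using (hlim v).const_mul c }
  let L' : E →L[ℝ] ℝ := L.mkContinuous R fun v => abs_le.2 (ha v)
  refine ⟨(InnerProductSpace.toDual ℝ E).symm L', fun v => ?_⟩
  rw [InnerProductSpace.toDual_symm_apply]
  exact hlim v

/-- A differentiable function with compact gradient is weakly continuous on bounded sets. -/
theorem IsCompactMap.tendsto_of_tendsto_inner {N : E → ℝ} {N' : E → E} (hN' : IsCompactMap N')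
    (hN : ∀ x, HasGradientAt N (N' x) x) {ι : Type*} {l : Filter ι} {u : ι → E} {x : E} {R : ℝ}
    (hu : ∀ᶠ i in l, ‖u i‖ ≤ R) (hw : ∀ v, Tendsto (fun i => ⟪u i, v⟫) l (𝓝 ⟪x, v⟫)) :
    Tendsto (fun i => N (u i)) l (𝓝 (N x)) := by
  rw [Metric.tendsto_nhds]
  intro ε hε
  have hK := (hN'.2 _ (Metric.isBounded_closedBall (x := (0 : E)) (r := R + ‖x‖))).totallyBounded
  set Q := max (R + ‖x‖) 0 + 1 with hQ
  have hQ0 : 0 < Q := by positivity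
  -- By the mean value theorem the increment of `N` pairs `u i - x` with some gradient value.
  -- Replacing that value by a point of the finite net costs at most `ε / 2`, and weak convergence
  -- is uniform over the net.
  obtain ⟨t, ht, hcov⟩ := Metric.totallyBounded_iff.1 hK (ε / (2 * Q)) (by positivity)
  have hfin : ∀ᶠ i in l, ∀ y ∈ t, |⟪u i - x, y⟫| < ε / 2 := by
    rw [eventually_all_finite ht]
    intro y _
    have h0 : Tendsto (fun i => |⟪u i - x, y⟫|) l (𝓝 0) := by
      simpa [inner_sub_left] using ((hw y).sub_const ⟪x, y⟫).abs
    exact h0.eventually_lt_const (by positivity)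
  filter_upwards [hu, hfin] with i hi hti
  obtain ⟨θ, hθ, h⟩ := exists_sub_eq_inner_gradient hN x (u i - x)
  rw [add_sub_cancel] at h
  have hmem : N' (x + θ • (u i - x)) ∈ closure (N' '' Metric.closedBall 0 (R + ‖x‖)) := by
    refine subset_closure (mem_image_of_mem _ ?_)
    rw [mem_closedBall_zero_iff]
    have : x + θ • (u i - x) = (1 - θ) • x + θ • u i := by module
    rw [this]
    refine (norm_add_le _ _).trans ?_
    rw [norm_smul, norm_smul, Real.norm_of_nonneg hθ.1.le,
      Real.norm_of_nonneg (by linarith [hθ.2] : 0 ≤ 1 - θ)]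
    nlinarith [norm_nonneg x, norm_nonneg (u i), hθ.1, hθ.2]
  obtain ⟨y, hy, hky⟩ := mem_iUnion₂.1 (hcov hmem)
  rw [mem_ball_iff_norm] at hky
  set k := N' (x + θ • (u i - x))
  have hn : ‖u i - x‖ ≤ Q := by
    have := norm_sub_le (u i) x
    have := le_max_left (R + ‖x‖) 0
    linarith
  have h1 : |⟪k - y, u i - x⟫| ≤ ε / (2 * Q) * Q :=
    (abs_real_inner_le_norm _ _).trans (by gcongr)
  have h2 : ε / (2 * Q) * Q = ε / 2 := by field_simp
  have h3 := hti y hy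
  rw [Real.dist_eq, h, show ⟪k, u i - x⟫ = ⟪k - y, u i - x⟫ + ⟪u i - x, y⟫ by
    rw [inner_sub_left, real_inner_comm y (u i - x)]; ring]
  refine (abs_add_le _ _).trans_lt ?_
  linarith

/-- Expanding `‖u i - x‖² ≥ 0` bounds `‖u i‖² / 2` below by `⟪u i, x⟫ - ‖x‖² / 2`, which passes to
the weak limit. -/
theorem norm_sq_half_add_le_of_tendsto {E : Type*} [NormedAddCommGroup E]
    [InnerProductSpace ℝ E] {ι : Type*} {l : Filter ι} [l.NeBot] {u : ι → E} {x : E}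
    (hw : ∀ v, Tendsto (fun i => ⟪u i, v⟫) l (𝓝 ⟪x, v⟫)) {c b : ι → ℝ} {c₀ β : ℝ}
    (hc : Tendsto c l (𝓝 c₀)) (hb : Tendsto b l (𝓝 β))
    (h : ∀ᶠ i in l, ‖u i‖ ^ 2 / 2 + c i ≤ b i) : ‖x‖ ^ 2 / 2 + c₀ ≤ β := by
  have h1 : Tendsto (fun i => ⟪u i, x⟫ - ‖x‖ ^ 2 / 2 + c i) l
      (𝓝 (⟪x, x⟫ - ‖x‖ ^ 2 / 2 + c₀)) := ((hw x).sub_const _).add hc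
  have h2 := le_of_tendsto_of_tendsto h1 hb (by
    filter_upwards [h] with i hi
    have := norm_sub_sq_real (u i) x
    nlinarith [sq_nonneg ‖u i - x‖])
  rw [real_inner_self_eq_norm_sq] at h2
  linarith

end WeakConvergence

/-! ### Third critical point from two global minimizers -/

section CompactPerturbation

variable {E : Type*} [NormedAddCommGroup E] [InnerProductSpace ℝ E] [CompleteSpace E]

theorem HasGradientAt.norm_sq_half_add {N : E → ℝ} {n x : E} (hN : HasGradientAt N n x) :
    HasGradientAt (fun x => ‖x‖ ^ 2 / 2 + N x) (x + n) x := by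
  rw [hasGradientAt_iff_hasFDerivAt] at hN ⊢
  have h := ((hasStrictFDerivAt_norm_sq x).hasFDerivAt.const_mul (1 / 2 : ℝ)).add hN
  refine (h.congr_fderiv ?_).congr_of_eventuallyEq (.of_forall fun y => ?_)
  · ext v
    simp
  · simp [div_eq_inv_mul]

theorem add_gradient_eq_zero_of_forall_le {N : E → ℝ} {n x : E} (hN : HasGradientAt N n x)
    (hx : ∀ z, ‖x‖ ^ 2 / 2 + N x ≤ ‖z‖ ^ 2 / 2 + N z) : x + n = 0 := by
  have h1 : IsLocalMin (fun x => ‖x‖ ^ 2 / 2 + N x) x := .of_forall hx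
  exact (map_eq_zero_iff _ (InnerProductSpace.toDual ℝ E).injective).1
    (h1.hasFDerivAt_eq_zero hN.norm_sq_half_add.hasFDerivAt)

theorem exists_ridge_of_sphere {E : Type*} [NormedAddCommGroup E] {f : E → ℝ} {a b : E} {r m' : ℝ} (hr : 0 ≤ r) (hrb : r ≤ ‖b - a‖)
    (h : ∀ c, ‖c - a‖ = r → m' ≤ f c) (γ : C(unitInterval, E)) (h0 : γ 0 = a) (h1 : γ 1 = b) :
    ∃ t, m' ≤ f (γ t) := by
  have hc : Continuous fun t => ‖γ t - a‖ := by fun_prop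
  obtain ⟨t, ht⟩ := mem_range_of_exists_le_of_exists_ge hc ⟨0, by simpa [h0] using hr⟩
    ⟨1, by simpa [h1] using hrb⟩
  exact ⟨t, h _ ht⟩

/-- A coercive functional `‖x‖² / 2 + N x` with `N` of compact gradient and with two global
minimizers has a third critical point. -/
theorem IsCompactMap.exists_third_critical_point {N : E → ℝ} {N' : E → E} (hN' : IsCompactMap N')
    (hN : ∀ x, HasGradientAt N (N' x) x)
    (hco : ∀ A, ∃ R, ∀ x, ‖x‖ ^ 2 / 2 + N x ≤ A → ‖x‖ ≤ R) {a b : E} (hab : a ≠ b)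
    (ha : ∀ z, ‖a‖ ^ 2 / 2 + N a ≤ ‖z‖ ^ 2 / 2 + N z)
    (hb : ∀ z, ‖b‖ ^ 2 / 2 + N b ≤ ‖z‖ ^ 2 / 2 + N z) :
    ∃ c, c ≠ a ∧ c ≠ b ∧ c + N' c = 0 := by
  set f : E → ℝ := fun x => ‖x‖ ^ 2 / 2 + N x with hf
  have hf' : ∀ x, HasGradientAt f (x + N' x) x := fun x => (hN x).norm_sq_half_add
  have hfc : Continuous f :=
    continuous_iff_continuousAt.2 fun x => (hf' x).hasFDerivAt.continuousAt
  have hba : 0 < ‖b - a‖ := norm_pos_iff.2 (sub_ne_zero.2 hab.symm)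
  by_cases hs : ∃ c, ‖c - a‖ = ‖b - a‖ / 2 ∧ f c ≤ f a
  · obtain ⟨c, hc, hca⟩ := hs
    refine ⟨c, ?_, ?_, add_gradient_eq_zero_of_forall_le (hN c) fun z => hca.trans (ha z)⟩
    · rintro rfl
      simp at hc
      linarith
    · rintro rfl
      linarith
  push Not at hs
  -- Otherwise points of the sphere with energy tending to the minimum have a weak limit that is a
  -- minimizer. Their norms converge too, so the limit is strong and lies on the sphere, which `hs`
  -- excludes.
  have hridge : ∃ m', f a < m' ∧ ∀ c, ‖c - a‖ = ‖b - a‖ / 2 → m' ≤ f c := by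
    by_contra! hcon
    have hseq : ∀ n : ℕ, ∃ c, ‖c - a‖ = ‖b - a‖ / 2 ∧ f c < f a + 1 / ((n : ℝ) + 1) := fun n =>
      hcon _ (lt_add_of_pos_right _ Nat.one_div_pos_of_nat)
    choose c hc hcf using hseq
    let U := hyperfilter ℕ
    have hU : (U : Filter ℕ) ≤ atTop := Nat.hyperfilter_le_atTop
    have hbd : ∀ᶠ n in U, ‖c n‖ ≤ ‖b - a‖ / 2 + ‖a‖ := .of_forall fun n => by
      have := norm_sub_norm_le (c n) a
      rw [hc n] at this
      linarith
    obtain ⟨x, hx⟩ := U.exists_forall_tendsto_inner hbd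
    have hNx := hN'.tendsto_of_tendsto_inner hN hbd hx
    have hlim : Tendsto (fun n : ℕ => f a + 1 / ((n : ℝ) + 1)) U (𝓝 (f a)) := by
      simpa using (tendsto_one_div_add_atTop_nhds_zero_nat (𝕜 := ℝ)).mono_left hU |>.const_add (f a)
    have hxa : f x ≤ f a :=
      norm_sq_half_add_le_of_tendsto hx hNx hlim (.of_forall fun n => (hcf n).le)
    have hflim : Tendsto (fun n => f (c n)) U (𝓝 (f x)) := by
      rw [le_antisymm hxa (ha x)]
      exact tendsto_of_tendsto_of_tendsto_of_le_of_le tendsto_const_nhds hlim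
        (fun n => ha _) fun n => (hcf n).le
    have hn : Tendsto (fun n => ‖c n - x‖ ^ 2) U (𝓝 0) := by
      have h := (((hflim.sub hNx).const_mul 2).sub ((hx x).const_mul 2)).add_const (‖x‖ ^ 2)
      rw [real_inner_self_eq_norm_sq] at h
      convert h using 1
      · ext n
        rw [norm_sub_sq_real]
        simp only [hf]
        ring
      · congr 1
        simp only [hf]
        ring
    have hcx : Tendsto c U (𝓝 x) := by
      rw [tendsto_iff_norm_sub_tendsto_zero]
      simpa using hn.sqrt
    have hxs : ‖x - a‖ = ‖b - a‖ / 2 := by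
      refine tendsto_nhds_unique ((hcx.sub_const a).norm) ?_
      simp [hc]
    exact absurd (hs x hxs) (not_lt.2 hxa)
  obtain ⟨m', hm', hsph⟩ := hridge
  have hcont : Continuous fun x => x + N' x := continuous_id.add hN'.1
  obtain ⟨B, hB⟩ := exists_norm_gradient_le_of_ridge hf' hcont ha rfl
    (le_antisymm (hb a) (ha b)) hm' (exists_ridge_of_sphere (by positivity) (by linarith) hsph)
  choose u hum huB hu using fun n : ℕ => hB (1 / ((n : ℝ) + 1)) Nat.one_div_pos_of_nat
  obtain ⟨R, hR⟩ := hco B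
  have hK := hN'.2 _ (Metric.isBounded_closedBall (x := (0 : E)) (r := R))
  -- Palais–Smale: `u n + N' (u n) → 0` and `N' (u n)` subconverges to `k`, so `u n` subconverges to
  -- `-k`. The level `m' > f a = f b` separates this limit from `a` and `b`.
  obtain ⟨k, -, φ, hφ, hk⟩ := hK.tendsto_subseq (x := fun n => N' (u n)) fun n =>
    subset_closure (mem_image_of_mem _ (mem_closedBall_zero_iff.2 (hR _ (huB n))))
  have h0 : Tendsto (fun n => u n + N' (u n)) atTop (𝓝 0) :=
    squeeze_zero_norm hu tendsto_one_div_add_atTop_nhds_zero_nat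
  have hlim : Tendsto (fun n => u (φ n)) atTop (𝓝 (0 - k)) := by
    simpa using (h0.comp hφ.tendsto_atTop).sub hk
  have hmc : m' ≤ f (0 - k) := ge_of_tendsto' ((hfc.tendsto _).comp hlim) fun n => hum (φ n)
  refine ⟨0 - k, ?_, ?_, ?_⟩
  · intro h
    rw [h] at hmc
    linarith
  · intro h
    rw [h] at hmc
    linarith [show f b ≤ f a from hb a]
  · exact tendsto_nhds_unique ((hcont.tendsto _).comp hlim) (h0.comp hφ.tendsto_atTop)

end CompactPerturbation

/-- A continuous real function that preserves midpoints is affine. -/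
theorem exists_affineMap_of_midpoint {E : Type*} [NormedAddCommGroup E] [NormedSpace ℝ E]
    {J : E → ℝ} (hJ : Continuous J)
    (h : ∀ x y, J ((1 / 2 : ℝ) • (x + y)) = (J x + J y) / 2) :
    ∃ A : E →ᵃ[ℝ] ℝ, ∀ x, J x = A x := by
  have hadd : ∀ x y, J (x + y) - J 0 = (J x - J 0) + (J y - J 0) := by
    intro x y
    have h1 := h x y
    have h2 := h (x + y) 0
    rw [add_zero] at h2
    linarith
  let L : E →+ ℝ := { toFun := fun x => J x - J 0, map_zero' := sub_self _, map_add' := hadd }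
  let L' : E →L[ℝ] ℝ := L.toRealLinearMap (hJ.sub continuous_const)
  refine ⟨L'.toLinearMap.toAffineMap + AffineMap.const ℝ E (J 0), fun x => ?_⟩
  change J x = (J x - J 0) + J 0
  ring

/-! ### Minimax in the parameter: two global minimizers -/

section Minimax

variable {E : Type*} [NormedAddCommGroup E] [InnerProductSpace ℝ E]

/-- The functional with gradient `x + I' x + λ J' x - y`, where `p = (y, λ)`, normalized to be
linear in `p` and independent of `p` at the point `(a, t)` of `E × ℝ`. -/
noncomputable def tiltedEnergy (I J : E → ℝ) (a : E) (t : ℝ) (x : E) (p : E × ℝ) : ℝ :=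
  ‖x‖ ^ 2 / 2 + (I x + p.2 * (J x - t) - ⟪p.1, x - a⟫)

variable {I J : E → ℝ} {a : E} {t : ℝ}

theorem continuous_tiltedEnergy (I J : E → ℝ) (a : E) (t : ℝ) (x : E) :
    Continuous (tiltedEnergy I J a t x) := by
  unfold tiltedEnergy
  fun_prop

theorem tiltedEnergy_combo (x : E) (p q : E × ℝ) (s : ℝ) :
    tiltedEnergy I J a t x (p + s • (q - p)) =
      (1 - s) * tiltedEnergy I J a t x p + s * tiltedEnergy I J a t x q := by
  simp only [tiltedEnergy, Prod.fst_add, Prod.snd_add, Prod.smul_fst, Prod.smul_snd,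
    Prod.fst_sub, Prod.snd_sub, inner_add_left, inner_sub_left, real_inner_smul_left,
    smul_eq_mul]
  ring

/-- Completing the square, `I + λJ ≥ ((J + λ)² - λ² - C) / 2`; the linear term costs `P‖x‖ ≤ ‖x‖²/4
+ P²`. Uniformity in `p` is needed because parameters will vary along ultrafilters. -/
theorem exists_le_tiltedEnergy {C : ℝ} (hC : ∀ x, |2 * I x - J x ^ 2| ≤ C) (a : E) (t P : ℝ) :
    ∃ D, ∀ p : E × ℝ, ‖p‖ ≤ P → ∀ x, ‖x‖ ^ 2 / 4 - D ≤ tiltedEnergy I J a t x p := by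
  refine ⟨P ^ 2 + P ^ 2 / 2 + C / 2 + P * |t| + P * ‖a‖, fun p hp x => ?_⟩
  have h1 : ‖p.1‖ ≤ P := (norm_fst_le p).trans hp
  have h2 : |p.2| ≤ P := (norm_snd_le p).trans hp
  have h3 := (abs_le.1 (hC x)).1
  have h4 : p.2 * t ≤ P * |t| := by
    refine (le_abs_self _).trans ?_
    rw [abs_mul]
    gcongr
  have h5 : ⟪p.1, x - a⟫ ≤ P * ‖x‖ + P * ‖a‖ := by
    rw [← mul_add]
    refine (real_inner_le_norm _ _).trans ?_
    gcongr
    · exact (norm_nonneg _).trans h1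
    · exact norm_sub_le x a
  have h6 : p.2 ^ 2 ≤ P ^ 2 := sq_le_sq' (abs_le.1 h2).1 (abs_le.1 h2).2
  unfold tiltedEnergy
  nlinarith [sq_nonneg (J x + p.2), sq_nonneg (‖x‖ / 2 - P)]

theorem exists_norm_le_of_tiltedEnergy_le {C : ℝ} (hC : ∀ x, |2 * I x - J x ^ 2| ≤ C)
    (a : E) (t P A : ℝ) :
    ∃ R, ∀ p : E × ℝ, ‖p‖ ≤ P → ∀ x, tiltedEnergy I J a t x p ≤ A → ‖x‖ ≤ R := by
  obtain ⟨D, hD⟩ := exists_le_tiltedEnergy hC a t P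
  refine ⟨4 * (A + D) + 1, fun p hp x hx => ?_⟩
  have := hD p hp x
  nlinarith [sq_nonneg (‖x‖ - 1)]

variable [CompleteSpace E] {I' J' : E → E}

/-- Compactness and lower semicontinuity of the tilted energies along an ultrafilter. -/
theorem exists_tiltedEnergy_le_of_tendsto (hI : ∀ x, HasGradientAt I (I' x) x)
    (hJ : ∀ x, HasGradientAt J (J' x) x) (hI' : IsCompactMap I') (hJ' : IsCompactMap J')
    {C : ℝ} (hC : ∀ x, |2 * I x - J x ^ 2| ≤ C) {ι : Type*} {U : Ultrafilter ι} {u : ι → E}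
    {p : ι → E × ℝ} {p₀ : E × ℝ} {A : ℝ} (hp : Tendsto p U (𝓝 p₀))
    (h : ∀ᶠ i in U, tiltedEnergy I J a t (u i) (p i) ≤ A) :
    ∃ x, ∀ (q : ι → E × ℝ) (q₀ : E × ℝ) (b : ι → ℝ) (β : ℝ), Tendsto q U (𝓝 q₀) →
      Tendsto b U (𝓝 β) → (∀ᶠ i in U, tiltedEnergy I J a t (u i) (q i) ≤ b i) →
      tiltedEnergy I J a t x q₀ ≤ β := by
  obtain ⟨R, hR⟩ := exists_norm_le_of_tiltedEnergy_le hC a t (‖p₀‖ + 1) A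
  have hbd : ∀ᶠ i in U, ‖u i‖ ≤ R := by
    filter_upwards [h, hp.norm.eventually_le_const (lt_add_one _)] with i hi hpi
    exact hR _ hpi _ hi
  obtain ⟨x, hx⟩ := U.exists_forall_tendsto_inner hbd
  refine ⟨x, fun q q₀ b β hq hb hqb => ?_⟩
  have h1 : Tendsto (fun i => (q i).1) U (𝓝 q₀.1) := hq.fst_nhds
  have h2 : Tendsto (fun i => (q i).2) U (𝓝 q₀.2) := hq.snd_nhds
  have h3 : Tendsto (fun i => ⟪(q i).1 - q₀.1, u i⟫) U (𝓝 0) := by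
    have h4 : Tendsto (fun i => ‖(q i).1 - q₀.1‖ * R) U (𝓝 0) := by
      simpa using (h1.sub_const q₀.1).norm.mul_const R
    refine squeeze_zero_norm' ?_ h4
    filter_upwards [hbd] with i hi
    exact (norm_inner_le_norm _ _).trans (by gcongr)
  have h5 : Tendsto (fun i => ⟪(q i).1, u i - a⟫) U (𝓝 ⟪q₀.1, x - a⟫) := by
    have h6 := (h3.add (hx q₀.1)).sub (h1.inner (tendsto_const_nhds (x := a)) (𝕜 := ℝ))
    have h7 : (0 : ℝ) + ⟪x, q₀.1⟫ - ⟪q₀.1, a⟫ = ⟪q₀.1, x - a⟫ := by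
      rw [inner_sub_right, real_inner_comm, zero_add]
    rw [h7] at h6
    refine h6.congr fun i => ?_
    rw [inner_sub_left, inner_sub_right, real_inner_comm q₀.1 (u i)]
    ring
  exact norm_sq_half_add_le_of_tendsto hx
    (((hI'.tendsto_of_tendsto_inner hI hbd hx).add
      (h2.mul ((hJ'.tendsto_of_tendsto_inner hJ hbd hx).sub_const t))).sub h5) hb hqb

theorem exists_forall_tiltedEnergy_le (hI : ∀ x, HasGradientAt I (I' x) x)
    (hJ : ∀ x, HasGradientAt J (J' x) x) (hI' : IsCompactMap I') (hJ' : IsCompactMap J')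
    {C : ℝ} (hC : ∀ x, |2 * I x - J x ^ 2| ≤ C) (a : E) (t : ℝ) (p : E × ℝ) :
    ∃ x, ∀ z, tiltedEnergy I J a t x p ≤ tiltedEnergy I J a t z p := by
  obtain ⟨D, hD⟩ := exists_le_tiltedEnergy hC a t ‖p‖
  have hbdd : BddBelow (range fun x => tiltedEnergy I J a t x p) :=
    ⟨-D, by rintro _ ⟨x, rfl⟩; linarith [hD p le_rfl x, sq_nonneg ‖x‖]⟩
  obtain ⟨v, -, hv, hmem⟩ := exists_seq_tendsto_sInf (range_nonempty _) hbdd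
  choose u hu using hmem
  have hvU := hv.mono_left Nat.hyperfilter_le_atTop
  obtain ⟨x, hx⟩ := exists_tiltedEnergy_le_of_tendsto (a := a) (t := t) (u := u)
    hI hJ hI' hJ' hC (tendsto_const_nhds (x := p))
    ((hvU.eventually_le_const (lt_add_one _)).mono fun n hn => (hu n).le.trans hn)
  exact ⟨x, fun z => (hx _ p v _ tendsto_const_nhds hvU (.of_forall fun n => (hu n).le)).trans
    (csInf_le hbdd (mem_range_self z))⟩

/-- If the tilted energies with parameter in a compact convex set have unique minimizers, and
minima at most `M`, then one of these minimizers has energy at most `M` for all parameters. -/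
theorem exists_tiltedEnergy_le_of_isCompact (hI : ∀ x, HasGradientAt I (I' x) x)
    (hJ : ∀ x, HasGradientAt J (J' x) x) (hI' : IsCompactMap I') (hJ' : IsCompactMap J')
    {C : ℝ} (hC : ∀ x, |2 * I x - J x ^ 2| ≤ C) {T : Set (E × ℝ)} (hT : IsCompact T)
    (hTc : Convex ℝ T) (hTn : T.Nonempty) {ξ : E × ℝ → E}
    (hξ : ∀ p z, tiltedEnergy I J a t (ξ p) p ≤ tiltedEnergy I J a t z p)
    (huniq : ∀ p ∈ T, ∀ x, (∀ z, tiltedEnergy I J a t x p ≤ tiltedEnergy I J a t z p) → x = ξ p)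
    {M : ℝ} (hM : ∀ p, tiltedEnergy I J a t (ξ p) p ≤ M) :
    ∃ x, ∀ p ∈ T, tiltedEnergy I J a t x p ≤ M := by
  -- The minimum value is an infimum of continuous functions of `p`, so it attains its maximum over
  -- `T` at some `p₀`; the minimizer there is the required point.
  have husc : UpperSemicontinuousOn (fun p => tiltedEnergy I J a t (ξ p) p) T := by
    intro p _ y hy
    have h := (continuous_tiltedEnergy I J a t (ξ p)).continuousAt.eventually_lt_const hy
    filter_upwards [nhdsWithin_le_nhds h] with q hq
    exact (hξ q _).trans_lt hq
  obtain ⟨p₀, hp₀, hmax⟩ := husc.exists_isMaxOn hTn hT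
  refine ⟨ξ p₀, fun p hp => ?_⟩
  let r : ℕ → ℝ := fun n => 1 / ((n : ℝ) + 1)
  have hr : ∀ n, 0 < r n := fun n => Nat.one_div_pos_of_nat
  have hr1 : ∀ n, r n ≤ 1 := fun n =>
    div_le_one_of_le₀ (by linarith [(Nat.cast_nonneg n : (0 : ℝ) ≤ n)]) (by positivity)
  have hr0 : Tendsto r (hyperfilter ℕ) (𝓝 0) :=
    (tendsto_one_div_add_atTop_nhds_zero_nat (𝕜 := ℝ)).mono_left Nat.hyperfilter_le_atTop
  -- Maximality of `p₀` and affinity in the parameter give, after division by `r n`, that the energy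
  -- of `ξ (q n)` at `p` is at most the value at `p₀`. By uniqueness the weak limit of `ξ (q n)` is
  -- `ξ p₀`.
  let q : ℕ → E × ℝ := fun n => p₀ + r n • (p - p₀)
  have hqT : ∀ n, q n ∈ T := fun n => hTc.add_smul_sub_mem hp₀ hp ⟨(hr n).le, hr1 n⟩
  have hq : Tendsto q (hyperfilter ℕ) (𝓝 p₀) := by
    simpa using (hr0.smul_const (p - p₀)).const_add p₀
  have hle : ∀ n, tiltedEnergy I J a t (ξ (q n)) (q n) ≤ tiltedEnergy I J a t (ξ p₀) p₀ :=
    fun n => hmax (hqT n)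
  obtain ⟨x, hx⟩ := exists_tiltedEnergy_le_of_tendsto (a := a) (t := t) (u := fun n => ξ (q n))
    hI hJ hI' hJ' hC hq (.of_forall hle)
  have hxξ : x = ξ p₀ := huniq p₀ hp₀ x fun z =>
    hx q p₀ (fun n => tiltedEnergy I J a t z (q n)) _ hq
      (((continuous_tiltedEnergy I J a t z).tendsto p₀).comp hq) (.of_forall fun n => hξ _ _)
  refine le_trans ?_ (hM p₀)
  rw [← hxξ]
  refine hx (fun _ => p) p (fun _ => _) _ tendsto_const_nhds tendsto_const_nhds
    (.of_forall fun n => ?_)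
  have h1 := hle n
  have h2 := hξ p₀ (ξ (q n))
  rw [tiltedEnergy_combo] at h1
  have h3 := mul_le_mul_of_nonneg_left h2 (sub_nonneg.2 (hr1 n))
  rw [hxξ]
  refine le_of_mul_le_mul_left ?_ (hr n)
  linarith

/-- The same for a convex set of parameters that need not be compact. -/
theorem exists_tiltedEnergy_le_of_convex (hI : ∀ x, HasGradientAt I (I' x) x)
    (hJ : ∀ x, HasGradientAt J (J' x) x) (hI' : IsCompactMap I') (hJ' : IsCompactMap J')
    {C : ℝ} (hC : ∀ x, |2 * I x - J x ^ 2| ≤ C) {S : Set (E × ℝ)}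
    (hS : Convex ℝ S) (hSn : S.Nonempty) {ξ : E × ℝ → E}
    (hξ : ∀ p z, tiltedEnergy I J a t (ξ p) p ≤ tiltedEnergy I J a t z p)
    (huniq : ∀ p ∈ S, ∀ x, (∀ z, tiltedEnergy I J a t x p ≤ tiltedEnergy I J a t z p) → x = ξ p)
    {M : ℝ} (hM : ∀ p, tiltedEnergy I J a t (ξ p) p ≤ M) :
    ∃ x, ∀ p ∈ S, tiltedEnergy I J a t x p ≤ M := by
  classical
  obtain ⟨p₀, hp₀⟩ := hSn
  have hF : ∀ F : Finset S, ∃ x, tiltedEnergy I J a t x p₀ ≤ M ∧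
      ∀ p ∈ F, tiltedEnergy I J a t x p ≤ M := by
    intro F
    -- Including `p₀` every time bounds all the points `u F` through coercivity at one fixed
    -- parameter.
    let Q : Set (E × ℝ) := insert p₀ ((↑) '' (F : Set S))
    have hQ : Q.Finite := (F.finite_toSet.image _).insert p₀
    have hQS : convexHull ℝ Q ⊆ S := convexHull_min
      (insert_subset hp₀ (by rintro _ ⟨p, -, rfl⟩; exact p.2)) hS
    obtain ⟨x, hx⟩ := exists_tiltedEnergy_le_of_isCompact hI hJ hI' hJ' hC
      (hQ.isCompact_convexHull ℝ) (convex_convexHull ℝ Q)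
      ⟨p₀, subset_convexHull ℝ Q (mem_insert _ _)⟩ hξ (fun p hp => huniq p (hQS hp)) hM
    exact ⟨x, hx _ (subset_convexHull ℝ Q (mem_insert _ _)), fun p hp =>
      hx _ (subset_convexHull ℝ Q (mem_insert_of_mem _ (mem_image_of_mem _ hp)))⟩
  choose u hu₀ hu using hF
  obtain ⟨x, hx⟩ := exists_tiltedEnergy_le_of_tendsto (a := a) (t := t) (u := u)
    (U := Ultrafilter.of atTop) hI hJ hI' hJ' hC (tendsto_const_nhds (x := p₀)) (.of_forall hu₀)
  refine ⟨x, fun p hp => hx (fun _ => p) p (fun _ => M) M tendsto_const_nhds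
    tendsto_const_nhds (Ultrafilter.of_le atTop ?_)⟩
  filter_upwards [eventually_ge_atTop {⟨p, hp⟩}] with F hF
  exact hu F ⟨p, hp⟩ (hF (Finset.mem_singleton_self _))

/-- If `J` does not preserve the midpoint of `x₁` and `x₂`, then for some parameter in a dense
convex set the tilted energy has two minimizers. -/
theorem exists_two_minimizers_tiltedEnergy (hI : ∀ x, HasGradientAt I (I' x) x)
    (hJ : ∀ x, HasGradientAt J (J' x) x) (hI' : IsCompactMap I') (hJ' : IsCompactMap J')
    {C : ℝ} (hC : ∀ x, |2 * I x - J x ^ 2| ≤ C) {S : Set (E × ℝ)}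
    (hS : Convex ℝ S) (hSd : Dense S) {x₁ x₂ : E} (ha : a = (1 / 2 : ℝ) • (x₁ + x₂))
    (ht : t = (J x₁ + J x₂) / 2) (hne : J a ≠ t) :
    ∃ p ∈ S, ∃ x y, x ≠ y ∧ (∀ z, tiltedEnergy I J a t x p ≤ tiltedEnergy I J a t z p) ∧
      ∀ z, tiltedEnergy I J a t y p ≤ tiltedEnergy I J a t z p := by
  choose ξ hξ using exists_forall_tiltedEnergy_le hI hJ hI' hJ' hC a t
  by_contra! hcon
  have huniq : ∀ p ∈ S, ∀ x,
      (∀ z, tiltedEnergy I J a t x p ≤ tiltedEnergy I J a t z p) → x = ξ p := by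
    intro p hp x hx
    by_contra hxy
    obtain ⟨z, hz⟩ := hcon p hp x (ξ p) hxy hx
    exact (hz.trans_le (hξ p z)).false
  let M := (‖x₁‖ ^ 2 / 2 + I x₁ + (‖x₂‖ ^ 2 / 2 + I x₂)) / 2
  have hM : ∀ p, tiltedEnergy I J a t (ξ p) p ≤ M := by
    intro p
    have h1 := hξ p x₁
    have h2 := hξ p x₂
    have h3 : tiltedEnergy I J a t x₁ p + tiltedEnergy I J a t x₂ p = 2 * M := by
      simp only [tiltedEnergy, ha, ht, M, inner_sub_right, inner_add_right, inner_smul_right]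
      ring
    linarith
  obtain ⟨x, hx⟩ := exists_tiltedEnergy_le_of_convex hI hJ hI' hJ' hC hS hSd.nonempty hξ huniq hM
  have hall : ∀ p, tiltedEnergy I J a t x p ≤ M := by
    have hcl : IsClosed {p | tiltedEnergy I J a t x p ≤ M} :=
      isClosed_le (continuous_tiltedEnergy I J a t x) continuous_const
    intro p
    exact hcl.closure_subset_iff.2 hx (hSd p)
  set K := ‖x‖ ^ 2 / 2 + I x with hK
  have hxa : x = a := by
    rw [← sub_eq_zero, ← norm_eq_zero]
    by_contra h0
    -- This parameter makes the energy exactly `M + 1`; the one for `J x - t` below does likewise.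
    have h := hall (-(((M - K + 1) / ‖x - a‖ ^ 2) • (x - a)), 0)
    simp only [tiltedEnergy, inner_neg_left, real_inner_smul_left, real_inner_self_eq_norm_sq]
      at h
    rw [div_mul_cancel₀ _ (pow_ne_zero 2 h0)] at h
    linarith
  have hJt : J x - t = 0 := by
    by_contra h0
    have h := hall (0, (M - K + 1) / (J x - t))
    simp only [tiltedEnergy, inner_zero_left, div_mul_cancel₀ _ h0] at h
    linarith
  rw [hxa] at hJt
  exact hne (sub_eq_zero.1 hJt)

end Minimax

/-! ### The perturbation of `‖x‖² / 2`: compactness and gradient -/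

section

variable {E : Type*} [NormedAddCommGroup E] [InnerProductSpace ℝ E]

theorem IsCompactMap.add_smul_sub_const {S T : E → E} (hS : IsCompactMap S) (hT : IsCompactMap T)
    (c : ℝ) (y : E) : IsCompactMap fun x => S x + c • T x - y := by
  refine ⟨(hS.1.add (hT.1.const_smul c)).sub continuous_const, fun B hB => ?_⟩
  have hK := (hS.2 B hB).prod (hT.2 B hB)
  have hK' := hK.image (f := fun p : E × E => p.1 + c • p.2 - y) (by fun_prop)
  refine hK'.of_isClosed_subset isClosed_closure (closure_minimal ?_ hK'.isClosed)
  rintro _ ⟨x, hx, rfl⟩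
  exact ⟨(S x, T x), ⟨subset_closure (mem_image_of_mem _ hx),
    subset_closure (mem_image_of_mem _ hx)⟩, rfl⟩

theorem HasGradientAt.add_mul_sub_inner [CompleteSpace E] {I J : E → ℝ} {i j x : E}
    (hI : HasGradientAt I i x) (hJ : HasGradientAt J j x) (c t : ℝ) (y a : E) :
    HasGradientAt (fun x => I x + c * (J x - t) - ⟪y, x - a⟫) (i + c • j - y) x := by
  rw [hasGradientAt_iff_hasFDerivAt] at hI hJ ⊢
  have h : HasFDerivAt (fun x => ⟪y, x - a⟫) (innerSL ℝ y) x := by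
    simpa only [inner_sub_right, innerSL_apply_apply] using
      (innerSL ℝ y).hasFDerivAt.sub_const (x := x) ⟪y, a⟫
  refine ((hI.add ((hJ.sub_const t).const_mul c)).sub h).congr_fderiv ?_
  ext v
  simp

end

theorem theorem2p9 {H : Type*} [NormedAddCommGroup H] [InnerProductSpace ℝ H] [CompleteSpace H]
    (I J : H → ℝ)
    (hI : ContDiff ℝ 1 I) (hJ : ContDiff ℝ 1 J)
    (hI' : IsCompactMap (gradient I)) (hJ' : IsCompactMap (gradient J))
    (hbdd : ∃ C : ℝ, ∀ x : H, |2 * I x - J x ^ 2| ≤ C)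
    (haff : ¬ ∃ A : H →ᵃ[ℝ] ℝ, ∀ x : H, J x = A x)
    (S : Set (H × ℝ)) (hconv : Convex ℝ S) (hdense : Dense S) :
    ∃ p ∈ S, 3 ≤ Set.encard {x : H | x + gradient I x + p.2 • gradient J x = p.1} := by
  obtain ⟨C, hC⟩ := hbdd
  have hIg : ∀ x, HasGradientAt I (gradient I x) x := fun x =>
    ((hI.differentiable one_ne_zero) x).hasGradientAt
  have hJg : ∀ x, HasGradientAt J (gradient J x) x := fun x =>
    ((hJ.differentiable one_ne_zero) x).hasGradientAt
  have hmid : ∃ x₁ x₂, J ((1 / 2 : ℝ) • (x₁ + x₂)) ≠ (J x₁ + J x₂) / 2 := by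
    by_contra! h
    exact haff (exists_affineMap_of_midpoint hJ.continuous h)
  obtain ⟨x₁, x₂, hne⟩ := hmid
  obtain ⟨p, hp, x, y, hxy, hx, hy⟩ :=
    exists_two_minimizers_tiltedEnergy hIg hJg hI' hJ' hC hconv hdense rfl rfl hne
  refine ⟨p, hp, ?_⟩
  generalize (1 / 2 : ℝ) • (x₁ + x₂) = a at hx hy
  generalize (J x₁ + J x₂) / 2 = t at hx hy
  have hN := fun x => (hIg x).add_mul_sub_inner (hJg x) p.2 t p.1 a
  have hN' := hI'.add_smul_sub_const hJ' p.2 p.1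
  obtain ⟨z, hzx, hzy, hz⟩ := hN'.exists_third_critical_point hN (fun A => by
    obtain ⟨R, hR⟩ := exists_norm_le_of_tiltedEnergy_le hC a t ‖p‖ A
    exact ⟨R, hR p le_rfl⟩) hxy hx hy
  have hsol : ∀ w : H, w + (gradient I w + p.2 • gradient J w - p.1) = 0 →
      w + gradient I w + p.2 • gradient J w = p.1 := by
    intro w hw
    rw [← sub_eq_zero, ← hw]
    abel
  have hsub : {x, y, z} ⊆ {x : H | x + gradient I x + p.2 • gradient J x = p.1} := by
    rintro w (rfl | rfl | rfl)
    · exact hsol _ (add_gradient_eq_zero_of_forall_le (hN _) hx)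
    · exact hsol _ (add_gradient_eq_zero_of_forall_le (hN _) hy)
    · exact hsol _ hz
  calc (3 : ℕ∞) = ({x, y, z} : Set H).encard :=
        (encard_eq_three.2 ⟨x, y, z, hxy, hzx.symm, hzy.symm, rfl⟩).symm
    _ ≤ _ := encard_le_encard hsub
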